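/- Let $M^n$ be a smooth $n$-dimensional manifold (Hausdorff, second countable, without boundary) with a smooth Riemannian metric $g$, let $m$ be a positive integer, and let $\psi,\lambda$ be smooth real functions on $M$ such that $(M^n,g,\psi,\lambda)$ is a generalized $m$-quasi-Einstein manifold, i.e. $$\mathrm{Ric}+\nabla^2\psi-\frac1m\,d\psi\otimes d\psi=\lambda g .$$ Put $u=e^{-\psi/m}$ and, for $1$-forms, $\alpha\wedge\beta=\alpha\otimes\beta-\beta\otimes\alpha$. Then on all of $M$ $$(n+m-2)\,d\lambda\wedge du=-\frac{u}{m}(n+m-2)\,d\lambda\wedge d\psi=0\qquad\text{and}\qquad d\lambda\wedge d\psi=0 .$$ In particular, if $n\ge 2$, then there is a function $\eta:M\to\mathbb R$, smooth on the open set $\{\nabla\psi\neq0\}$ of regular points of $\psi$, such that $\nabla\lambda=\eta\nabla\psi$ on that set. If $n\ge2$ and, moreover, the set $\{\nabla\psi=0\}$ of critical points of $\psi$ is discrete (possibly empty) in its subspace topology, then there is a function $\eta:M\to\mathbb R$ with $\nabla\lambda=\eta\nabla\psi$ on all of $M$. -/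

import Mathlib

open scoped Manifold ContDiff Bundle

noncomputable section

namespace QuasiEinstein

/-- The model space `ℝⁿ` with its Euclidean norm. -/
abbrev Euc (n : ℕ) : Type := EuclideanSpace ℝ (Fin n)

/-- Smooth Riemannian metrics on a smooth `n`-manifold `M` without boundary. -/
abbrev Metric (n : ℕ) (M : Type*) [TopologicalSpace M] [ChartedSpace (Euc n) M]
    [IsManifold (𝓡 n) ∞ M] : Type _ :=
  Bundle.ContMDiffRiemannianMetric (𝓡 n) ∞ (Euc n) (fun x : M => TangentSpace (𝓡 n) x)

/-! ### Local coordinates -/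

/-- The `i`-th standard basis vector of `ℝⁿ`. -/
def stdVec {n : ℕ} (i : Fin n) : Euc n := EuclideanSpace.single i (1 : ℝ)

/-- The partial derivative `∂ᵢ F` at `y` of a function of `n` real variables. -/
def pd {n : ℕ} (i : Fin n) (F : Euc n → ℝ) (y : Euc n) : ℝ := fderiv ℝ F y (stdVec i)

section Coordinates

variable {n : ℕ} {M : Type*} [TopologicalSpace M] [ChartedSpace (Euc n) M]

/-- The coordinate vector field `∂ᵢ` of the chart `e`, at the point with coordinates `y`. -/
def coordVec (e : OpenPartialHomeomorph M (Euc n)) (i : Fin n) (y : Euc n) :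
    TangentSpace (𝓡 n) (e.symm y) :=
  mfderiv (𝓡 n) (𝓡 n) e.symm y (stdVec i)

/-- The expression `f ∘ e⁻¹` of a function `f` in the chart `e`. -/
def inChart (e : OpenPartialHomeomorph M (Euc n)) (f : M → ℝ) (y : Euc n) : ℝ := f (e.symm y)

variable [IsManifold (𝓡 n) ∞ M]

/-- The matrix of components `g i j = g(∂ᵢ, ∂ⱼ)` of the metric in the chart `e`. -/
def metricMatrix (g : Metric n M) (e : OpenPartialHomeomorph M (Euc n)) (y : Euc n) :
    Matrix (Fin n) (Fin n) ℝ :=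
  Matrix.of fun i j => g.inner (e.symm y) (coordVec e i y) (coordVec e j y)

/-- The Christoffel symbols of the Levi-Civita connection in the chart `e`,
`Γᵏᵢⱼ = ½ ∑ₗ gᵏˡ (∂ᵢ gⱼₗ + ∂ⱼ gᵢₗ - ∂ₗ gᵢⱼ)`. -/
def christoffel (g : Metric n M) (e : OpenPartialHomeomorph M (Euc n)) (k i j : Fin n)
    (y : Euc n) : ℝ :=
  (1 / 2) * ∑ l, (metricMatrix g e y)⁻¹ k l *
    (pd i (fun z => metricMatrix g e z j l) y + pd j (fun z => metricMatrix g e z i l) y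
      - pd l (fun z => metricMatrix g e z i j) y)

/-- The components of the Ricci tensor in the chart `e`,
`Rᵢⱼ = ∑ₖ (∂ₖ Γᵏᵢⱼ - ∂ⱼ Γᵏᵢₖ) + ∑ₖₗ (Γᵏₖₗ Γˡᵢⱼ - Γᵏⱼₗ Γˡᵢₖ)`, with the sign convention in which
the round unit `n`-sphere has `Ric = (n - 1) g`. -/
def ricci (g : Metric n M) (e : OpenPartialHomeomorph M (Euc n)) (i j : Fin n)
    (y : Euc n) : ℝ :=
  ∑ k, (pd k (christoffel g e k i j) y - pd j (christoffel g e k i k) y)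
    + ∑ k, ∑ l, (christoffel g e k k l y * christoffel g e l i j y
      - christoffel g e k j l y * christoffel g e l i k y)

/-- The components `∂ᵢ∂ⱼ f - ∑ₖ Γᵏᵢⱼ ∂ₖ f` of the Hessian `∇²f` in the chart `e`. -/
def hessian (g : Metric n M) (e : OpenPartialHomeomorph M (Euc n)) (f : M → ℝ) (i j : Fin n)
    (y : Euc n) : ℝ :=
  pd i (pd j (inChart e f)) y - ∑ k, christoffel g e k i j y * pd k (inChart e f) y

/-- `(M, g, ψ, lam)` is a generalized `m`-quasi-Einstein manifold: `m` is a positive integer, `ψ`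
and `lam` are smooth functions and `Ric + ∇²ψ - (1/m) dψ ⊗ dψ = lam g`, an equation of tensors
that is written out in the local coordinates of every chart of the atlas. -/
structure IsGeneralizedQuasiEinstein (m : ℕ) (g : Metric n M) (ψ lam : M → ℝ) : Prop where
  pos : 0 < m
  smooth_potential : ContMDiff (𝓡 n) 𝓘(ℝ, ℝ) ∞ ψ
  smooth_lam : ContMDiff (𝓡 n) 𝓘(ℝ, ℝ) ∞ lam
  equation : ∀ e ∈ atlas (Euc n) M, ∀ y ∈ e.target, ∀ i j : Fin n,
    ricci g e i j y + hessian g e ψ i j y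
        - (1 / (m : ℝ)) * (pd i (inChart e ψ) y * pd j (inChart e ψ) y)
      = lam (e.symm y) * metricMatrix g e y i j

end Coordinates

/-! ### Differentials, wedge products and gradients -/

/-- The wedge product of two covectors, `α ∧ β = α ⊗ β - β ⊗ α` (determinant convention), as a
function of two vectors. -/
def wedge {V : Type*} [AddCommGroup V] [Module ℝ V] [TopologicalSpace V]
    (α β : V →L[ℝ] ℝ) : V → V → ℝ :=
  fun v w => α v * β w - β v * α w

section Gradient

variable {n : ℕ} {M : Type*} [TopologicalSpace M] [ChartedSpace (Euc n) M]

/-- The differential `df` of a real function at the point `x`. -/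
def differential (n : ℕ) {M : Type*} [TopologicalSpace M] [ChartedSpace (Euc n) M]
    (f : M → ℝ) (x : M) : TangentSpace (𝓡 n) x →L[ℝ] ℝ :=
  mfderiv (𝓡 n) 𝓘(ℝ, ℝ) f x

variable [IsManifold (𝓡 n) ∞ M]

/-- The inner product on `T_x M` as a bilinear form. -/
def metricForm (g : Metric n M) (x : M) : LinearMap.BilinForm ℝ (TangentSpace (𝓡 n) x) :=
  LinearMap.mk₂ ℝ (fun v w => g.inner x v w) (by simp) (by simp) (by simp) (by simp)

theorem metricForm_nondegenerate (g : Metric n M) (x : M) : (metricForm g x).Nondegenerate := by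
  refine ⟨fun v hv => ?_, fun v hv => ?_⟩ <;>
  · by_contra hne
    exact (g.pos x v hne).ne' (hv v)

instance finiteDimensional_tangentSpace (x : M) :
    FiniteDimensional ℝ (TangentSpace (𝓡 n) x) :=
  inferInstanceAs (FiniteDimensional ℝ (Euc n))

/-- The gradient of `f` at `x`: the vector `∇f` with `g(∇f, v) = df(v)` for all `v`. -/
def grad (g : Metric n M) (f : M → ℝ) (x : M) : TangentSpace (𝓡 n) x :=
  ((metricForm g x).toDual (metricForm_nondegenerate g x)).symm
    (differential n f x).toLinearMap

theorem inner_grad (g : Metric n M) (f : M → ℝ) (x : M) (v : TangentSpace (𝓡 n) x) :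
    g.inner x (grad g f x) v = differential n f x v :=
  LinearMap.BilinForm.apply_toDual_symm_apply (hB := metricForm_nondegenerate g x)
    (differential n f x).toLinearMap v

end Gradient

end QuasiEinstein

end

noncomputable section

namespace QuasiEinstein

/-! ### Tensor calculus over a ring with commuting derivations -/

section TensorCalculus

open Matrix

variable {ι C : Type*} [CommRing C] [Algebra ℝ C]

/-! In a chart, write f = ψ, μ = λ, c = 1/m, q = |∇f|², S for the scalar curvature and R = S + (1 -
c) q. Raise an index in the equation and take its divergence. The contracted Bianchi identity gives
div Ric = dS/2, the Ricci identity gives div ∇²f = dΔf + Ric(∇f), and the equation itself expresses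
Ric(∇f). Eliminating Δf by the trace leaves dR = 2(n-1) dμ + 2(1 - cn) μ df + 2c R df. Applying d
once more gives 2(1 + c(n-2)) dμ ∧ df = 0 (`wedge_eq_zero`). For n ≥ 2 the factor 2(n+m-2)/m is
positive; for n < 2 every wedge vanishes.

The tensor calculus is pure algebra: it holds over any commutative ℝ-algebra with commuting
derivations, with the connection given by matrices. Applied to the smooth functions on a chart
domain, it yields the vanishing minors of `pd_mul_pd_comm`.

At regular points, η = dλ(∇ψ)/dψ(∇ψ). At an isolated critical point of ψ, dλ must vanish too:
otherwise dψ = ρ dλ nearby, with ρ constant along curves in the level sets of λ, so a whole curve of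
critical points would pass through the point (`frequently_pd_eq_zero`). -/

/-- The entrywise derivative of a matrix. -/
def matDeriv (D : Derivation ℝ C C) (A : Matrix ι ι C) : Matrix ι ι C := A.map D

theorem matDeriv_apply (D : Derivation ℝ C C) (A : Matrix ι ι C) (i j : ι) :
    matDeriv D A i j = D (A i j) := rfl

theorem matDeriv_add (D : Derivation ℝ C C) (A B : Matrix ι ι C) :
    matDeriv D (A + B) = matDeriv D A + matDeriv D B := by
  ext i j; simp [matDeriv_apply]

theorem matDeriv_sub (D : Derivation ℝ C C) (A B : Matrix ι ι C) :
    matDeriv D (A - B) = matDeriv D A - matDeriv D B := by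
  ext i j; simp [matDeriv_apply]

theorem matDeriv_neg (D : Derivation ℝ C C) (A : Matrix ι ι C) :
    matDeriv D (-A) = -matDeriv D A := by
  ext i j; simp [matDeriv_apply]

theorem matDeriv_transpose (D : Derivation ℝ C C) (A : Matrix ι ι C) :
    matDeriv D Aᵀ = (matDeriv D A)ᵀ := rfl

theorem matDeriv_one [DecidableEq ι] (D : Derivation ℝ C C) :
    matDeriv D (1 : Matrix ι ι C) = 0 := by
  ext i j
  by_cases h : i = j <;> simp [matDeriv_apply, h]

theorem matDeriv_comm {D : ι → Derivation ℝ C C} (hD : ∀ i j f, D i (D j f) = D j (D i f))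
    (i j : ι) (B : Matrix ι ι C) :
    matDeriv (D i) (matDeriv (D j) B) = matDeriv (D j) (matDeriv (D i) B) := by
  ext a b; exact hD i j _

variable [Fintype ι]

theorem matDeriv_mul (D : Derivation ℝ C C) (A B : Matrix ι ι C) :
    matDeriv D (A * B) = matDeriv D A * B + A * matDeriv D B := by
  ext i j
  simp only [matDeriv_apply, Matrix.mul_apply, Matrix.add_apply, map_sum, Derivation.leibniz,
    smul_eq_mul, ← Finset.sum_add_distrib]
  exact Finset.sum_congr rfl fun k _ => by ring

/-! ### Connections as matrices: curvature, Ricci tensor, Hessian, divergence -/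

/-- The curvature matrices `Fᵢⱼ = ∂ᵢAⱼ - ∂ⱼAᵢ + [Aᵢ, Aⱼ]` of a connection with matrices `Aᵢ`. -/
def curv (D : ι → Derivation ℝ C C) (A : ι → Matrix ι ι C) (i j : ι) : Matrix ι ι C :=
  matDeriv (D i) (A j) - matDeriv (D j) (A i) + (A i * A j - A j * A i)

/-- The Ricci tensor of a connection. -/
def ric (D : ι → Derivation ℝ C C) (A : ι → Matrix ι ι C) (i j : ι) : C :=
  ∑ k, curv D A k j k i

/-- The Ricci tensor with its first index raised by `H`. -/
def ricUp (D : ι → Derivation ℝ C C) (H : Matrix ι ι C) (A : ι → Matrix ι ι C) : Matrix ι ι C :=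
  of fun l k => ∑ p, H l p * ric D A p k

/-- The Hessian of `f`. -/
def hess (D : ι → Derivation ℝ C C) (A : ι → Matrix ι ι C) (f : C) (i j : ι) : C :=
  D i (D j f) - ∑ r, A i r j * D r f

/-- The gradient vector of `f`. -/
def gradVec (D : ι → Derivation ℝ C C) (H : Matrix ι ι C) (f : C) (l : ι) : C :=
  ∑ p, H l p * D p f

/-- The covariant derivative `∇ₖ wˡ` of a vector field `w`, as a matrix with upper index first. -/
def covDeriv (D : ι → Derivation ℝ C C) (A : ι → Matrix ι ι C) (w : ι → C) : Matrix ι ι C :=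
  of fun l k => D k (w l) + ∑ p, A k l p * w p

/-- The divergence of an endomorphism field `B`, with upper index first. -/
def divergence (D : ι → Derivation ℝ C C) (A : ι → Matrix ι ι C) (B : Matrix ι ι C) (k : ι) : C :=
  ∑ l, D l (B l k) + (∑ l, ∑ p, A l l p * B p k - ∑ l, ∑ p, A k l p * B p l)

/-- `A` is the Levi-Civita connection of the metric with inverse matrix `H`; the entry `A k i j` is
the Christoffel symbol `Γⁱₖⱼ`. -/
structure IsLeviCivita (D : ι → Derivation ℝ C C) (H : Matrix ι ι C) (A : ι → Matrix ι ι C) :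
    Prop where
  comm : ∀ i j f, D i (D j f) = D j (D i f)
  symm : Hᵀ = H
  torsion : ∀ i j k, A i k j = A j k i
  compat : ∀ k, matDeriv (D k) H = -(A k * H + H * (A k)ᵀ)

/-! ### Bianchi and Ricci identities -/

variable {D : ι → Derivation ℝ C C} {H : Matrix ι ι C} {A : ι → Matrix ι ι C}

theorem curv_swap (i j : ι) : curv D A j i = -curv D A i j := by
  unfold curv; abel

/-- The second Bianchi identity. -/
theorem bianchi [DecidableEq ι] (hD : ∀ i j f, D i (D j f) = D j (D i f)) (i j k : ι) :
    (matDeriv (D i) (curv D A j k) + (A i * curv D A j k - curv D A j k * A i))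
      + (matDeriv (D j) (curv D A k i) + (A j * curv D A k i - curv D A k i * A j))
      + (matDeriv (D k) (curv D A i j) + (A k * curv D A i j - curv D A i j * A k)) = 0 := by
  simp only [curv, matDeriv_add, matDeriv_sub, matDeriv_mul]
  -- With second derivatives put in a common order, what remains is a noncommutative polynomial
  -- identity.
  rw [matDeriv_comm hD j i, matDeriv_comm hD k i, matDeriv_comm hD k j]
  noncomm_ring

theorem divergence_add (B B' : Matrix ι ι C) (k : ι) :
    divergence D A (B + B') k = divergence D A B k + divergence D A B' k := by
  simp only [divergence, Matrix.add_apply, map_add, mul_add, Finset.sum_add_distrib]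
  ring

/-- The Ricci identity for the commutator of covariant derivatives. -/
theorem covDeriv_comm [DecidableEq ι] (hD : ∀ i j f, D i (D j f) = D j (D i f)) (w : ι → C)
    (i j l : ι) :
    D i (covDeriv D A w l j) + ∑ p, A i l p * covDeriv D A w p j
      = D j (covDeriv D A w l i) + ∑ p, A j l p * covDeriv D A w p i
        + ∑ p, curv D A i j l p * w p := by
  -- Every column of the square matrix `W` is `w`, so the vector identity becomes a matrix identity.
  set W : Matrix ι ι C := of fun l _ => w l with hW
  have hN : ∀ a b c, covDeriv D A w a b = (matDeriv (D b) W + A b * W) a c := fun a b c => by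
    simp [covDeriv, matDeriv_apply, hW, mul_apply]
  have key : matDeriv (D i) (matDeriv (D j) W + A j * W) + A i * (matDeriv (D j) W + A j * W)
      = matDeriv (D j) (matDeriv (D i) W + A i * W) + A j * (matDeriv (D i) W + A i * W)
        + curv D A i j * W := by
    simp only [curv, matDeriv_add, matDeriv_mul]
    rw [matDeriv_comm hD j i]
    noncomm_ring
  have key' := congrFun (congrFun key l) l
  simp only [hN _ _ l]
  rw [Matrix.add_apply, Matrix.add_apply, Matrix.add_apply, mul_apply, mul_apply, mul_apply] at key'
  exact key'

namespace IsLeviCivita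

/-- The commutator of `D i` and `D j` kills `H`; expanded by metric compatibility it equals -(F H +
H Fᵀ), where F is the curvature matrix. -/
theorem curv_mul_transpose [DecidableEq ι] (h : IsLeviCivita D H A) (i j : ι) :
    (curv D A i j * H)ᵀ = -(curv D A i j * H) := by
  have key := matDeriv_comm h.comm i j H
  simp only [h.compat, matDeriv_neg, matDeriv_add, matDeriv_mul, matDeriv_transpose] at key
  simp only [curv, add_mul, sub_mul, transpose_add, transpose_sub, transpose_mul, h.symm]
  rw [← sub_eq_zero] at key ⊢
  rw [← neg_eq_zero, ← key]
  noncomm_ring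

/-- The covariant derivative of the curvature with one index raised. -/
def covCurv (D : ι → Derivation ℝ C C) (H : Matrix ι ι C) (A : ι → Matrix ι ι C) (i j k : ι) :
    Matrix ι ι C :=
  matDeriv (D i) (curv D A j k * H) + A i * (curv D A j k * H) + (curv D A j k * H) * (A i)ᵀ

theorem covCurv_swap (i j k : ι) : covCurv D H A i k j = -covCurv D H A i j k := by
  simp only [covCurv, curv_swap j k, neg_mul, matDeriv_neg, mul_neg]
  abel

theorem covCurv_transpose [DecidableEq ι] (h : IsLeviCivita D H A) (i j k : ι) :
    (covCurv D H A i j k)ᵀ = -covCurv D H A i j k := by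
  simp only [covCurv, transpose_add, transpose_mul, ← matDeriv_transpose]
  rw [← transpose_mul, h.curv_mul_transpose, transpose_transpose]
  simp only [matDeriv_neg, neg_mul, mul_neg]
  abel

/-- Compatibility lets `H` pass through the covariant derivative, so this is the second Bianchi
identity multiplied by `H`. Only the two matrix indices are differentiated covariantly: for a
torsion-free connection the terms on the other two cancel in the cyclic sum. -/
theorem covCurv_cyclic [DecidableEq ι] (h : IsLeviCivita D H A) (i j k : ι) :
    covCurv D H A i j k + covCurv D H A j k i + covCurv D H A k i j = 0 := by
  have key := congrArg (· * H) (bianchi (A := A) h.comm i j k)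
  simp only [zero_mul] at key
  rw [← key]
  simp only [covCurv, matDeriv_mul, h.compat]
  noncomm_ring

theorem sum_curv_mul (h : IsLeviCivita D H A) (l k : ι) :
    ∑ m, (curv D A m k * H) m l = ricUp D H A l k := by
  simp only [mul_apply, ricUp, ric, of_apply, Finset.mul_sum]
  rw [Finset.sum_comm]
  refine Finset.sum_congr rfl fun p _ => Finset.sum_congr rfl fun m _ => ?_
  rw [← h.symm, transpose_apply, mul_comm, h.symm]

theorem sum_symm_mul_antisymm {S K : ι → ι → C} (hS : ∀ i j, S i j = S j i)
    (hK : ∀ i j, K i j = -K j i) : ∑ i, ∑ j, S i j * K i j = 0 := by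
  have : ∑ i, ∑ j, S i j * K i j = -∑ i, ∑ j, S i j * K i j := by
    conv_lhs => rw [Finset.sum_comm]
    simp only [← Finset.sum_neg_distrib]
    exact Finset.sum_congr rfl fun i _ => Finset.sum_congr rfl fun j _ => by
      rw [hS, hK]; ring
  have h2 : (2 : ℝ) • ∑ i, ∑ j, S i j * K i j = 0 := by
    rw [two_smul]; exact add_eq_zero_iff_eq_neg.2 this
  simpa using h2

/-- The contracted second Bianchi identity `2 div Ric = dR`. -/
theorem two_mul_divergence_ricUp [DecidableEq ι] (h : IsLeviCivita D H A) (k : ι) :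
    2 * divergence D A (ricUp D H A) k = D k (∑ l, ricUp D H A l l) := by
  set Q := ricUp D H A with hQ
  set K : ι → ι → Matrix ι ι C := fun i j => curv D A i j * H with hK
  have K1 : ∀ i j a b, K j i a b = -K i j a b := fun i j a b => by
    simp only [hK]; rw [curv_swap, neg_mul, Matrix.neg_apply]
  have K2 : ∀ i j a b, K i j b a = -K i j a b := fun i j a b =>
    congrFun (congrFun (h.curv_mul_transpose i j) a) b
  have Q1 : ∀ l, ∑ m, K m k m l = Q l k := fun l => h.sum_curv_mul l k
  have Q2 : ∀ l p, ∑ m, K l m p m = Q p l := fun l p => by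
    rw [hQ, ← h.sum_curv_mul]
    exact Finset.sum_congr rfl fun m _ => by rw [K1 m l, K2 m l m p, neg_neg]
  have Q3 : ∀ l p, ∑ m, K m l m p = Q p l := fun l p => h.sum_curv_mul p l
  have Q4 : ∀ l, ∑ m, K m k l m = -Q l k := fun l => by
    rw [← Q1, ← Finset.sum_neg_distrib]
    exact Finset.sum_congr rfl fun m _ => K2 _ _ _ _
  -- Full contraction of the cyclic identity. The first two sums agree and give the divergence of
  -- Ricci without its `A k` term; the third gives the differential of the scalar curvature together
  -- with that missing term, twice.
  have cyc : ∑ l, ∑ m, (covCurv D H A l m k l m + covCurv D H A m k l l m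
      + covCurv D H A k l m l m) = 0 :=
    Finset.sum_eq_zero fun l _ => Finset.sum_eq_zero fun m _ =>
      congrFun (congrFun (h.covCurv_cyclic l m k) l) m
  have hT : ∀ i j p a b, covCurv D H A i j p a b
      = D i (K j p a b) + ∑ r, A i a r * K j p r b + ∑ r, K j p a r * A i b r :=
    fun i j p a b => by
      simp only [covCurv, Matrix.add_apply, matDeriv_apply, mul_apply (M := A i),
        mul_apply (N := (A i)ᵀ), transpose_apply, hK]
  have S1 : ∑ l, ∑ m, covCurv D H A l m k l m
      = -(∑ l, D l (Q l k) + ∑ l, ∑ p, A l l p * Q p k) := by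
    simp only [hT, Finset.sum_add_distrib]
    have e1 : ∑ l, ∑ m, D l (K m k l m) = -∑ l, D l (Q l k) := by
      simp only [← map_sum, Q4, map_neg, Finset.sum_neg_distrib]
    have e2 : ∑ l, ∑ m, ∑ r, A l l r * K m k r m = -∑ l, ∑ p, A l l p * Q p k := by
      simp only [← Finset.sum_neg_distrib]
      refine Finset.sum_congr rfl fun l _ => ?_
      rw [Finset.sum_comm]
      exact Finset.sum_congr rfl fun r _ => by rw [← Finset.mul_sum, Q4, mul_neg]
    -- Christoffel symbols, symmetric in `l` and `r`, meet curvature, antisymmetric in them.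
    have e3 : ∑ l, ∑ m, ∑ r, K m k l r * A l m r = 0 := by
      rw [Finset.sum_comm]
      refine Finset.sum_eq_zero fun m _ => ?_
      have := sum_symm_mul_antisymm (S := fun l r => A l m r) (K := fun l r => K m k l r)
        (fun i j => h.torsion i j m) (fun i j => K2 _ _ _ _)
      simpa only [mul_comm] using this
    rw [e1, e2, e3]; ring
  have S2 : ∑ l, ∑ m, covCurv D H A m k l l m = ∑ l, ∑ m, covCurv D H A l m k l m := by
    rw [Finset.sum_comm]
    refine Finset.sum_congr rfl fun l _ => Finset.sum_congr rfl fun m _ => ?_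
    rw [covCurv_swap, Matrix.neg_apply, ← transpose_apply (covCurv D H A l m k), h.covCurv_transpose,
      Matrix.neg_apply, neg_neg]
  have S3 : ∑ l, ∑ m, covCurv D H A k l m l m
      = D k (∑ l, Q l l) + 2 * ∑ l, ∑ p, A k l p * Q p l := by
    simp only [hT, Finset.sum_add_distrib]
    have e1 : ∑ l, ∑ m, D k (K l m l m) = D k (∑ l, Q l l) := by
      simp only [← map_sum, Q2]
    have e2 : ∑ l, ∑ m, ∑ r, A k l r * K l m r m = ∑ l, ∑ p, A k l p * Q p l := by
      refine Finset.sum_congr rfl fun l _ => ?_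
      rw [Finset.sum_comm]
      exact Finset.sum_congr rfl fun r _ => by rw [← Finset.mul_sum, Q2]
    have e3 : ∑ l, ∑ m, ∑ r, K l m l r * A k m r = ∑ l, ∑ p, A k l p * Q p l := by
      rw [Finset.sum_comm]
      refine Finset.sum_congr rfl fun m _ => ?_
      rw [Finset.sum_comm]
      exact Finset.sum_congr rfl fun r _ => by rw [← Finset.sum_mul, Q3, mul_comm]
    rw [e1, e2, e3]; ring
  simp only [Finset.sum_add_distrib] at cyc
  rw [S2, S1, S3] at cyc
  unfold divergence
  linear_combination -cyc

/-! ### Gradients, Hessians and their divergences -/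

/-- The gradient is covariantly differentiated to the Hessian. -/
theorem covDeriv_gradVec (h : IsLeviCivita D H A) (f : C) (l k : ι) :
    covDeriv D A (gradVec D H f) l k = ∑ p, H l p * hess D A f k p := by
  have hH : ∀ p, D k (H l p) = -(∑ r, A k l r * H r p + ∑ r, H l r * A k p r) := fun p =>
    congrFun (congrFun (h.compat k) l) p
  simp only [covDeriv, gradVec, hess, of_apply, map_sum, Derivation.leibniz, smul_eq_mul, hH,
    mul_sub, neg_add, mul_add, mul_neg, Finset.sum_add_distrib, Finset.sum_sub_distrib,
    Finset.sum_neg_distrib, Finset.mul_sum]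
  have e1 : ∑ p, ∑ r, D p f * (A k l r * H r p) = ∑ r, ∑ p, A k l r * (H r p * D p f) := by
    rw [Finset.sum_comm]
    exact Finset.sum_congr rfl fun r _ => Finset.sum_congr rfl fun p _ => by ring
  have e2 : ∑ p, ∑ r, D p f * (H l r * A k p r) = ∑ r, ∑ p, H l r * (A k p r * D p f) := by
    rw [Finset.sum_comm]
    exact Finset.sum_congr rfl fun r _ => Finset.sum_congr rfl fun p _ => by ring
  rw [e1, e2]; ring

theorem hess_symm (h : IsLeviCivita D H A) (f : C) (i j : ι) :
    hess D A f i j = hess D A f j i := by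
  simp only [hess, h.comm i j, h.torsion i j]

/-- The divergence of the covariant derivative of a vector field. -/
theorem divergence_covDeriv [DecidableEq ι] (h : IsLeviCivita D H A) (w : ι → C) (k : ι) :
    divergence D A (covDeriv D A w) k
      = D k (∑ l, covDeriv D A w l l) + ∑ p, ric D A p k * w p := by
  have key : ∑ l, (D l (covDeriv D A w l k) + ∑ p, A l l p * covDeriv D A w p k)
      = ∑ l, (D k (covDeriv D A w l l) + ∑ p, A k l p * covDeriv D A w p l
        + ∑ p, curv D A l k l p * w p) :=
    Finset.sum_congr rfl fun l _ => covDeriv_comm h.comm w l k l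
  have e : ∑ l, ∑ p, curv D A l k l p * w p = ∑ p, ric D A p k * w p := by
    rw [Finset.sum_comm]
    simp only [ric, Finset.sum_mul]
  simp only [Finset.sum_add_distrib, e] at key
  rw [divergence, map_sum]
  linear_combination key

/-- The divergence of `∇f ⊗ df`. -/
theorem divergence_gradVec_mul (f : C) (k : ι) :
    divergence D A (of fun l k => gradVec D H f l * D k f) k
      = (∑ l, covDeriv D A (gradVec D H f) l l) * D k f
        + ∑ l, gradVec D H f l * (D l (D k f) - ∑ r, A k r l * D r f) := by
  simp only [divergence, covDeriv, of_apply, Derivation.leibniz, smul_eq_mul,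
    Finset.sum_add_distrib, mul_sub, Finset.sum_sub_distrib, add_mul, Finset.sum_mul,
    Finset.mul_sum]
  have e : ∑ l, ∑ p, A k l p * (gradVec D H f p * D l f)
      = ∑ p, ∑ l, gradVec D H f p * (A k l p * D l f) := by
    rw [Finset.sum_comm]
    exact Finset.sum_congr rfl fun r _ => Finset.sum_congr rfl fun p _ => by ring
  rw [e]
  simp only [mul_assoc, mul_comm (D _ f)]
  ring

theorem divergence_scalar [DecidableEq ι] (h : IsLeviCivita D H A) (f : C) (k : ι) :
    divergence D A (of fun l k => if l = k then f else 0) k = D k f := by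
  have e1 : ∑ l, D l (if l = k then f else 0) = D k f := by
    rw [Finset.sum_eq_single k] <;> simp +contextual
  simp only [divergence, of_apply, e1, mul_ite, mul_zero, Finset.sum_ite_eq', Finset.mem_univ,
    if_true]
  simp only [h.torsion k, sub_self, add_zero]

theorem sum_gradVec_mul (h : IsLeviCivita D H A) (f : C) (B : ι → C) :
    ∑ p, gradVec D H f p * B p = ∑ l, D l f * ∑ p, H l p * B p := by
  simp only [gradVec, Finset.sum_mul, Finset.mul_sum]
  rw [Finset.sum_comm]
  refine Finset.sum_congr rfl fun l _ => Finset.sum_congr rfl fun p _ => ?_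
  rw [← h.symm, transpose_apply, h.symm]; ring

/-- The differential of `|∇f|²`. -/
theorem deriv_normSq (h : IsLeviCivita D H A) (f : C) (k : ι) :
    D k (∑ l, gradVec D H f l * D l f)
      = 2 * ∑ l, D l f * covDeriv D A (gradVec D H f) l k := by
  have e1 : ∑ l, D l f * covDeriv D A (gradVec D H f) l k
      = ∑ l, gradVec D H f l * hess D A f k l := by
    rw [h.sum_gradVec_mul]; simp only [h.covDeriv_gradVec]
  -- One copy is kept as a covariant derivative of the gradient, the other rewritten through the
  -- Hessian; their Christoffel terms cancel.
  rw [two_mul]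
  nth_rw 2 [e1]
  simp only [map_sum, Derivation.leibniz, smul_eq_mul, covDeriv, hess, of_apply, mul_add, mul_sub,
    Finset.sum_add_distrib, Finset.sum_sub_distrib, Finset.mul_sum]
  have e : ∑ l, ∑ p, D l f * (A k l p * gradVec D H f p)
      = ∑ p, ∑ l, gradVec D H f p * (A k l p * D l f) := by
    rw [Finset.sum_comm]
    exact Finset.sum_congr rfl fun r _ => Finset.sum_congr rfl fun p _ => by ring
  rw [e]; ring

/-- The equation `Ric + ∇²f - c df ⊗ df = μ g` with constant `c` makes `dμ ∧ df` vanish, up to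
the factor `1 + c (n - 2)`. -/
theorem wedge_eq_zero [DecidableEq ι] (h : IsLeviCivita D H A) {G : Matrix ι ι C} (hG : H * G = 1)
    {f μ c : C} (hc : ∀ i, D i c = 0)
    (heq : ∀ i j, ric D A i j + hess D A f i j - c * (D i f * D j f) = μ * G i j) (i j : ι) :
    2 * (1 + c * (Fintype.card ι - 2)) * (D i μ * D j f - D j μ * D i f) = 0 := by
  set w := gradVec D H f with hw
  set N := covDeriv D A w with hN
  set Q := ricUp D H A with hQ
  set q := ∑ l, w l * D l f with hq
  set S := ∑ l, Q l l with hS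
  set Δ := ∑ l, N l l with hΔ
  have mixed : ∀ l k, Q l k + N l k
      = c * (w l * D k f) + (if l = k then μ else 0) := fun l k => by
    have e : ∑ p, H l p * (ric D A p k + hess D A f p k - c * (D p f * D k f))
        = μ * (H * G) l k := by
      simp only [heq, mul_apply, Finset.mul_sum]
      exact Finset.sum_congr rfl fun p _ => by ring
    have e2 : ∑ p, H l p * (c * (D p f * D k f)) = c * (w l * D k f) := by
      simp only [hw, gradVec, Finset.sum_mul, Finset.mul_sum]
      exact Finset.sum_congr rfl fun p _ => by ring
    simp only [mul_add, mul_sub, Finset.sum_add_distrib, Finset.sum_sub_distrib, e2, hG] at e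
    rw [hN, h.covDeriv_gradVec, hQ, ricUp, of_apply]
    simp only [h.hess_symm f k]
    rw [one_apply, mul_ite, mul_one, mul_zero] at e
    linear_combination e
  have trace : S + Δ = c * q + Fintype.card ι * μ := by
    rw [hS, hΔ, ← Finset.sum_add_distrib]
    simp only [mixed, if_true, Finset.sum_add_distrib, ← Finset.mul_sum]
    simp [hq]
  have hX : ∀ k, ∑ l, D l f * N l k = ∑ l, w l * hess D A f k l := fun k => by
    rw [hw, h.sum_gradVec_mul]; simp only [hN, hw, h.covDeriv_gradVec]
  -- Ric(∇f) is read off from the equation contracted with ∇f.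
  have hric : ∀ k, ∑ p, ric D A p k * w p
      = c * q * D k f + μ * D k f - ∑ l, D l f * N l k := fun k => by
    have e : ∑ p, ric D A p k * w p = ∑ l, D l f * Q l k := by
      simp only [mul_comm _ (w _)]
      rw [hw, h.sum_gradVec_mul]; rfl
    rw [e, eq_sub_iff_add_eq, ← Finset.sum_add_distrib]
    simp only [← mul_add, mixed]
    simp only [mul_add, Finset.sum_add_distrib, mul_ite, mul_zero, Finset.sum_ite_eq',
      Finset.mem_univ, if_true, hq, Finset.mul_sum, Finset.sum_mul]
    rw [mul_comm μ]
    congr 1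
    exact Finset.sum_congr rfl fun p _ => by ring
  have hdiv : ∀ k, divergence D A Q k + divergence D A N k
      = c * (Δ * D k f + ∑ l, D l f * N l k) + D k μ := fun k => by
    have e : Q + N = (of fun l k => c * (w l * D k f))
        + of fun l k => if l = k then μ else 0 := by
      ext l k; exact mixed l k
    have e2 : divergence D A (of fun l k => c * (w l * D k f)) k
        = c * divergence D A (of fun l k => w l * D k f) k := by
      simp only [divergence, of_apply, Derivation.leibniz, smul_eq_mul, hc, mul_zero, add_zero,
        mul_add, mul_sub, Finset.mul_sum, mul_left_comm c]
      congr 1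
      exact Finset.sum_congr rfl fun p _ => by ring
    rw [← divergence_add, e, divergence_add, e2, hw, divergence_gradVec_mul, h.divergence_scalar,
      hX]
    simp only [hess, h.comm k, hw, hΔ, hN]
  -- The combination S + (1 - c) q is chosen so that its differential involves only dμ, μ df and
  -- itself times df: contracted Bianchi removes div Ric, `deriv_normSq` removes ∇²f(∇f), and the
  -- trace removes Δ.
  have P : ∀ k, D k (S + (1 - c) * q) = 2 * (Fintype.card ι - 1) * D k μ
      + 2 * (1 - c * Fintype.card ι) * (μ * D k f) + 2 * c * ((S + (1 - c) * q) * D k f) :=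
    fun k => by
      have e1 := hdiv k
      rw [hN, h.divergence_covDeriv, ← hN, ← hΔ, hric] at e1
      have e2 := h.two_mul_divergence_ricUp k
      have e3 := h.deriv_normSq f k
      rw [← hQ, ← hS] at e2
      rw [← hw, ← hN, ← hq] at e3
      have e4 := congrArg (D k) trace
      simp only [map_add, map_sub, Derivation.leibniz, smul_eq_mul, hc, Derivation.map_natCast,
        Derivation.map_one_eq_zero, mul_zero, add_zero, sub_zero] at e4 ⊢
      linear_combination -2 * e1 + e2 + (1 + c) * e3 + 2 * e4 - 2 * c * D k f * trace
  have two : ∀ i, D i (2 : C) = 0 := fun i => mod_cast (D i).map_natCast 2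
  -- Integrability of `P`. The direct terms contribute 1 - cn, and substituting `P` for the
  -- derivatives of R contributes 2c(n-1); together they make 1 + c(n-2).
  have hPij := h.comm i j (S + (1 - c) * q)
  have Pi := P i
  have Pj := P j
  generalize S + (1 - c) * q = R at *
  rw [Pi, Pj] at hPij
  simp only [map_add, map_sub, Derivation.leibniz, smul_eq_mul, hc, two,
    Derivation.map_natCast, Derivation.map_one_eq_zero, mul_zero, add_zero, sub_zero, h.comm j i,
    Pi, Pj] at hPij
  linear_combination hPij

end IsLeviCivita

/-! ### The Christoffel formula gives the Levi-Civita connection -/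

/-- The matrices of Christoffel symbols of the metric `G` with inverse `H`. -/
def christoffelMatrix (D : ι → Derivation ℝ C C) (H G : Matrix ι ι C) (k : ι) : Matrix ι ι C :=
  of fun i j => (1 / 2 : ℝ) • ∑ l, H i l * (D k (G j l) + D j (G k l) - D l (G k j))

/-- Lowering the upper index with `G` and symmetrizing leaves D G = G A + (G A)ᵀ; differentiating H
G = 1 turns this into compatibility with `H`. -/
theorem isLeviCivita_christoffelMatrix [DecidableEq ι] {G : Matrix ι ι C}
    (hD : ∀ i j f, D i (D j f) = D j (D i f)) (hGs : Gᵀ = G) (hHG : H * G = 1) :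
    IsLeviCivita D H (christoffelMatrix D H G) := by
  have hGH : G * H = 1 := mul_eq_one_comm.1 hHG
  have hHs : Hᵀ = H := by
    have : Hᵀ * G = 1 := by
      rw [← transpose_one, ← hGH, transpose_mul, hGs]
    calc Hᵀ = Hᵀ * (G * H) := by rw [hGH, mul_one]
      _ = H := by rw [← mul_assoc, this, one_mul]
  have hGe : ∀ i j, G i j = G j i := fun i j => congrFun (congrFun hGs j) i
  have lower : ∀ k, G * christoffelMatrix D H G k
      = of fun a j => (1 / 2 : ℝ) • (D k (G j a) + D j (G k a) - D a (G k j)) := fun k => by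
    have e : christoffelMatrix D H G k
        = H * of fun a j => (1 / 2 : ℝ) • (D k (G j a) + D j (G k a) - D a (G k j)) := by
      ext i j
      simp only [christoffelMatrix, of_apply, mul_apply, Finset.smul_sum, mul_smul_comm]
    rw [e, ← mul_assoc, hGH, one_mul]
  refine ⟨hD, hHs, fun i j k => ?_, fun k => ?_⟩
  · simp only [christoffelMatrix, of_apply]
    congr 1
    refine Finset.sum_congr rfl fun l _ => ?_
    rw [hGe i j, add_comm (D i (G j l))]
  · set A := christoffelMatrix D H G k with hA
    have hG : matDeriv (D k) G = G * A + (G * A)ᵀ := by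
      rw [lower k]
      ext a b
      simp only [matDeriv_apply, Matrix.add_apply, transpose_apply, of_apply, ← smul_add]
      have e : D k (G b a) + D b (G k a) - D a (G k b) + (D k (G a b) + D a (G k b) - D b (G k a))
          = (2 : ℝ) • D k (G a b) := by
        rw [hGe b a, two_smul]; ring
      rw [e, smul_smul]; norm_num
    have key : matDeriv (D k) H * G + H * matDeriv (D k) G = 0 := by
      rw [← matDeriv_mul, hHG, matDeriv_one]
    calc matDeriv (D k) H = (matDeriv (D k) H * G) * H := by rw [mul_assoc, hGH, mul_one]
      _ = -(H * matDeriv (D k) G) * H := by rw [eq_neg_of_add_eq_zero_left key]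
      _ = -((H * G) * A * H + H * Aᵀ * (G * H)) := by
        rw [hG, transpose_mul, hGs]; noncomm_ring
      _ = -(A * H + H * Aᵀ) := by rw [hHG, hGH, one_mul, mul_one]

end TensorCalculus

end QuasiEinstein

end

noncomputable section

namespace QuasiEinstein

/-! ### The ring of smooth functions on an open subset of `ℝⁿ` -/

section SmoothFunctions

open TopologicalSpace

variable {n : ℕ}

/-- Smooth functions on the open set `U`. -/
def smoothFun (U : Opens (Euc n)) : Subalgebra ℝ (U → ℝ) where
  carrier := {f | ∃ F : Euc n → ℝ, ContDiffOn ℝ ∞ F U ∧ ∀ y : U, F y = f y}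
  mul_mem' := by
    rintro f f' ⟨F, hF, h⟩ ⟨F', hF', h'⟩
    exact ⟨fun y => F y * F' y, hF.mul hF', fun y => by simp [h, h']⟩
  add_mem' := by
    rintro f f' ⟨F, hF, h⟩ ⟨F', hF', h'⟩
    exact ⟨fun y => F y + F' y, hF.add hF', fun y => by simp [h, h']⟩
  algebraMap_mem' r := ⟨fun _ => r, contDiffOn_const, fun _ => rfl⟩

variable {U : Opens (Euc n)}

/-- The extension by zero. -/
def extendZero (f : smoothFun U) : Euc n → ℝ := Function.extend Subtype.val f.1 0

theorem extendZero_apply (f : smoothFun U) (y : U) : extendZero f y = f.1 y :=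
  Subtype.val_injective.extend_apply _ _ _

theorem extendZero_eqOn {f : smoothFun U} {F : Euc n → ℝ} (h : ∀ y : U, F y = f.1 y) :
    Set.EqOn F (extendZero f) U := fun y hy => by
  rw [extendZero_apply f ⟨y, hy⟩]; exact h ⟨y, hy⟩

theorem contDiffOn_extendZero (f : smoothFun U) : ContDiffOn ℝ ∞ (extendZero f) U := by
  obtain ⟨F, hF, h⟩ := f.2
  exact hF.congr fun y hy => (extendZero_eqOn h hy).symm

theorem differentiableAt_extendZero (f : smoothFun U) (y : U) :
    DifferentiableAt ℝ (extendZero f) y :=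
  ((contDiffOn_extendZero f).differentiableOn (by simp)).differentiableAt
    (U.isOpen.mem_nhds y.2)

theorem contDiffOn_pd {F : Euc n → ℝ} (hF : ContDiffOn ℝ ∞ F U) (i : Fin n) :
    ContDiffOn ℝ ∞ (pd i F) U :=
  (hF.fderiv_of_isOpen U.isOpen (by simp)).clm_apply contDiffOn_const

/-- Since U is open, derivatives on U ignore values outside it; hence the choice of extension is
harmless. -/
theorem pd_congr {F G : Euc n → ℝ} (h : Set.EqOn F G U) (i : Fin n) :
    Set.EqOn (pd i F) (pd i G) U := fun y hy => by
  have : F =ᶠ[nhds y] G := h.eventuallyEq_of_mem (U.isOpen.mem_nhds hy)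
  rw [pd, pd, this.fderiv_eq]

/-- The partial derivative as a derivation of the ring of smooth functions. -/
def pdDerivation (U : Opens (Euc n)) (i : Fin n) :
    Derivation ℝ (smoothFun U) (smoothFun U) :=
  Derivation.mk'
    { toFun := fun f => ⟨fun y => pd i (extendZero f) y, pd i (extendZero f),
        contDiffOn_pd (contDiffOn_extendZero f) i, fun _ => rfl⟩
      map_add' := fun f g => by
        ext y
        have := pd_congr (extendZero_eqOn (F := fun y => extendZero f y + extendZero g y)
          (f := f + g) (fun y => by simp [extendZero_apply])) i y.2
        change pd i (extendZero (f + g)) y = pd i (extendZero f) y + pd i (extendZero g) y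
        rw [← this, pd, fderiv_fun_add (differentiableAt_extendZero f y)
          (differentiableAt_extendZero g y)]
        rfl
      map_smul' := fun c f => by
        ext y
        have := pd_congr (extendZero_eqOn (F := fun y => c * extendZero f y)
          (f := c • f) (fun y => by simp [extendZero_apply])) i y.2
        change pd i (extendZero (c • f)) y = c * pd i (extendZero f) y
        rw [← this, pd, fderiv_const_mul (differentiableAt_extendZero f y)]
        rfl }
    fun f g => by
      ext y
      have := pd_congr (extendZero_eqOn (F := fun y => extendZero f y * extendZero g y)
        (f := f * g) (fun y => by simp [extendZero_apply])) i y.2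
      change pd i (extendZero (f * g)) y
        = f.1 y * pd i (extendZero g) y + g.1 y * pd i (extendZero f) y
      rw [← this, pd, fderiv_fun_mul (differentiableAt_extendZero f y)
        (differentiableAt_extendZero g y), ← extendZero_apply, ← extendZero_apply]
      rfl

/-- The bridge between coordinate formulas on ℝⁿ and the algebraic calculus. -/
theorem pd_eq_pdDerivation {F : Euc n → ℝ} {f : smoothFun U} (h : ∀ y : U, F y = f.1 y)
    (i : Fin n) (y : U) : pd i F y = (pdDerivation U i f).1 y :=
  pd_congr (extendZero_eqOn h) i y.2

theorem pd_comm {F : Euc n → ℝ} {y : Euc n} (hF : ContDiffAt ℝ ∞ F y) (i j : Fin n) :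
    pd i (pd j F) y = pd j (pd i F) y := by
  have hs : IsSymmSndFDerivAt ℝ F y := hF.isSymmSndFDerivAt (by
    rw [minSmoothness_of_isRCLikeNormedField]; exact WithTop.coe_le_coe.2 (OrderTop.le_top (2 : ℕ∞)))
  have hd : DifferentiableAt ℝ (fderiv ℝ F) y :=
    (hF.fderiv_right (m := 1) (by norm_cast)).differentiableAt (by simp)
  have e : ∀ a b, pd a (pd b F) y = fderiv ℝ (fderiv ℝ F) y (stdVec a) (stdVec b) := fun a b => by
    change fderiv ℝ (fun z => fderiv ℝ F z (stdVec b)) y (stdVec a) = _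
    rw [fderiv_clm_apply hd (differentiableAt_const _)]
    simp
  rw [e, e]
  exact hs _ _

theorem pdDerivation_comm (i j : Fin n) (f : smoothFun U) :
    pdDerivation U i (pdDerivation U j f) = pdDerivation U j (pdDerivation U i f) := by
  ext y
  have e : ∀ a b, (pdDerivation U a (pdDerivation U b f)).1 y = pd a (pd b (extendZero f)) y :=
    fun a b => (pd_eq_pdDerivation (fun z => (pd_eq_pdDerivation (extendZero_apply f) b z)) a y).symm
  rw [e, e]
  exact pd_comm ((contDiffOn_extendZero f).contDiffAt (U.isOpen.mem_nhds y.2)) i j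

/-- A smooth function without zeros is a unit. -/
theorem isUnit_smoothFun {f : smoothFun U} (h : ∀ y, f.1 y ≠ 0) : IsUnit f := by
  refine IsUnit.of_mul_eq_one ⟨fun y => (f.1 y)⁻¹, fun y => (extendZero f y)⁻¹,
    (contDiffOn_extendZero f).inv fun y hy => ?_, fun y => ?_⟩ ?_
  · rw [extendZero_apply f ⟨y, hy⟩]; exact h _
  · simp only [extendZero_apply]
  · ext y
    exact mul_inv_cancel₀ (h y)

/-- Evaluation at a point. -/
def evalSmooth (y : U) : smoothFun U →+* ℝ :=
  (Pi.evalRingHom (fun _ : U => ℝ) y).comp (smoothFun U).val.toRingHom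

theorem evalSmooth_apply (y : U) (f : smoothFun U) : evalSmooth y f = f.1 y := rfl

end SmoothFunctions

end QuasiEinstein

end

noncomputable section

namespace QuasiEinstein

/-! ### The metric and the differentials in a chart -/

section Charts

open TopologicalSpace

variable {n : ℕ} {M : Type*} [TopologicalSpace M] [ChartedSpace (Euc n) M]

theorem sum_smul_coordVec (e : OpenPartialHomeomorph M (Euc n)) (y : Euc n) (v : Fin n → ℝ) :
    ∑ i, v i • coordVec e i y = mfderiv (𝓡 n) (𝓡 n) e.symm y (WithLp.toLp 2 v) := by
  have hv : WithLp.toLp 2 v = ∑ i, v i • (stdVec i : Euc n) := by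
    ext k
    simp [stdVec, Pi.single_apply]
  have := map_sum (mfderiv (𝓡 n) (𝓡 n) e.symm y) (fun i => v i • (stdVec i : Euc n)) Finset.univ
  rw [← hv] at this
  refine Eq.trans ?_ this.symm
  exact Finset.sum_congr rfl fun i _ => ((mfderiv (𝓡 n) (𝓡 n) e.symm y).map_smul _ _).symm

variable [IsManifold (𝓡 n) ∞ M] {e : OpenPartialHomeomorph M (Euc n)}

theorem contMDiffOn_symm_of_mem_atlas (he : e ∈ atlas (Euc n) M) :
    ContMDiffOn (𝓡 n) (𝓡 n) ∞ e.symm e.target :=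
  contMDiffOn_symm_of_mem_maximalAtlas (IsManifold.subset_maximalAtlas he)

theorem mdifferentiable_chart_of_mem_atlas (he : e ∈ atlas (Euc n) M) :
    e.MDifferentiable (𝓡 n) (𝓡 n) := by
  have : IsManifold (𝓡 n) 1 M := IsManifold.of_le (n := ∞) (by norm_cast)
  exact mdifferentiable_of_mem_atlas he

/-- The field is the image of a constant section under the tangent map of `e.symm`. -/
theorem contMDiffOn_coordVec (he : e ∈ atlas (Euc n) M) (i : Fin n) :
    ContMDiffOn (𝓡 n) (𝓡 n).tangent ∞
      (fun y => Bundle.TotalSpace.mk' (Euc n) (E := TangentSpace (𝓡 n) (M := M)) (e.symm y)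
        (coordVec e i y)) e.target := by
  have h1 := (contMDiffOn_symm_of_mem_atlas he).contMDiffOn_tangentMapWithin (m := ∞)
    (by simp) e.open_target.uniqueMDiffOn
  have h2 : ContMDiffOn (𝓡 n) (𝓡 n).tangent ∞
      (fun y : Euc n => Bundle.TotalSpace.mk' (Euc n) (E := TangentSpace (𝓡 n) (M := Euc n)) y
        (stdVec i)) e.target := fun y _ =>
    contMDiffWithinAt_vectorSpace_iff_contDiffWithinAt.2 contDiffWithinAt_const
  refine (h1.comp h2 fun y hy => hy).congr fun y hy => ?_
  simp only [Function.comp, tangentMapWithin, coordVec,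
    mfderivWithin_of_isOpen e.open_target hy]

theorem contDiffOn_metricMatrix (g : Metric n M) (he : e ∈ atlas (Euc n) M) (i j : Fin n) :
    ContDiffOn ℝ ∞ (fun y => metricMatrix g e y i j) e.target := by
  rw [← contMDiffOn_iff_contDiffOn]
  have h := ContMDiffOn.clm_bundle_apply₂ (IB := 𝓡 n) (F₁ := Euc n) (F₂ := Euc n) (F₃ := ℝ)
    (E₁ := TangentSpace (𝓡 n) (M := M)) (E₂ := TangentSpace (𝓡 n) (M := M))
    (E₃ := Bundle.Trivial M ℝ) (b := e.symm) (s := e.target)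
    (ψ := fun y => g.inner (e.symm y))
    (g.contMDiff.comp_contMDiffOn (contMDiffOn_symm_of_mem_atlas he))
    (contMDiffOn_coordVec he i) (contMDiffOn_coordVec he j)
  intro y hy
  have := h y hy
  simp only [Bundle.contMDiffWithinAt_totalSpace] at this
  exact this.2

theorem mfderiv_symm_bijective (he : e ∈ atlas (Euc n) M) {y : Euc n} (hy : y ∈ e.target) :
    Function.Bijective (mfderiv (𝓡 n) (𝓡 n) e.symm y) :=
  (mdifferentiable_chart_of_mem_atlas he).symm.mfderiv_bijective hy

theorem exists_eq_sum_coordVec (he : e ∈ atlas (Euc n) M) {y : Euc n} (hy : y ∈ e.target)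
    (w : TangentSpace (𝓡 n) (e.symm y)) : ∃ v : Fin n → ℝ, w = ∑ i, v i • coordVec e i y := by
  obtain ⟨v, hv⟩ := (mfderiv_symm_bijective he hy).2 w
  exact ⟨WithLp.ofLp v, by rw [sum_smul_coordVec]; exact hv.symm⟩

/-- A kernel vector would be the components of a nonzero tangent vector of length zero. -/
theorem det_metricMatrix_ne_zero (g : Metric n M) (he : e ∈ atlas (Euc n) M) {y : Euc n}
    (hy : y ∈ e.target) : (metricMatrix g e y).det ≠ 0 := by
  intro h0
  obtain ⟨v, hv, hv0⟩ := Matrix.exists_mulVec_eq_zero_iff.2 h0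
  have hw : ∑ i, v i • coordVec e i y ≠ 0 := by
    rw [sum_smul_coordVec]
    intro h
    have := (mfderiv_symm_bijective he hy).1 (h.trans (map_zero _).symm)
    exact hv (congrArg WithLp.ofLp this)
  refine (g.pos _ _ hw).ne' ?_
  have e1 : ∀ i, g.inner (e.symm y) (coordVec e i y) (∑ j, v j • coordVec e j y) = 0 :=
    fun i => by
      have := congrFun hv0 i
      simp only [Matrix.mulVec, dotProduct, metricMatrix, Matrix.of_apply, Pi.zero_apply] at this
      rw [← this, map_sum]
      exact Finset.sum_congr rfl fun j _ => by rw [map_smul, smul_eq_mul, mul_comm]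
  rw [map_sum]
  exact Finset.sum_eq_zero fun i _ => by rw [map_smul, g.symm, e1, smul_zero]

theorem contDiffOn_inChart {f : M → ℝ} (hf : ContMDiff (𝓡 n) 𝓘(ℝ, ℝ) ∞ f)
    (he : e ∈ atlas (Euc n) M) : ContDiffOn ℝ ∞ (inChart e f) e.target :=
  (hf.comp_contMDiffOn (contMDiffOn_symm_of_mem_atlas he)).contDiffOn

theorem pd_inChart {f : M → ℝ} (hf : ContMDiff (𝓡 n) 𝓘(ℝ, ℝ) ∞ f) (he : e ∈ atlas (Euc n) M)
    {y : Euc n} (hy : y ∈ e.target) (i : Fin n) :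
    pd i (inChart e f) y = differential n f (e.symm y) (coordVec e i y) := by
  have h := mfderiv_comp y (hf.mdifferentiableAt (by simp))
    ((mdifferentiable_chart_of_mem_atlas he).mdifferentiableAt_symm hy)
  have h2 : mfderiv (𝓡 n) 𝓘(ℝ, ℝ) (inChart e f) y = fderiv ℝ (inChart e f) y := mfderiv_eq_fderiv
  rw [pd, ← h2]
  exact DFunLike.congr_fun h (stdVec i)

/-- Two differentials whose components in a chart have vanishing minors are parallel. -/
theorem wedge_differential_eq_zero {f μ : M → ℝ} (hf : ContMDiff (𝓡 n) 𝓘(ℝ, ℝ) ∞ f)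
    (hμ : ContMDiff (𝓡 n) 𝓘(ℝ, ℝ) ∞ μ) (he : e ∈ atlas (Euc n) M) {y : Euc n}
    (hy : y ∈ e.target) (h : ∀ i j, pd i (inChart e μ) y * pd j (inChart e f) y
      = pd j (inChart e μ) y * pd i (inChart e f) y) :
    wedge (differential n μ (e.symm y)) (differential n f (e.symm y)) = 0 := by
  funext v w
  obtain ⟨a, rfl⟩ := exists_eq_sum_coordVec he hy v
  obtain ⟨b, rfl⟩ := exists_eq_sum_coordVec he hy w
  simp only [wedge, map_sum, map_smul, smul_eq_mul, ← pd_inChart hf he hy,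
    ← pd_inChart hμ he hy, Finset.sum_mul_sum, Pi.zero_apply]
  rw [sub_eq_zero]
  exact Finset.sum_congr rfl fun i _ => Finset.sum_congr rfl fun j _ => by
    linear_combination a i * b j * h i j

/-- The equation of a generalized quasi-Einstein manifold forces the minors
of `dlam` and `dψ` to vanish. -/
theorem pd_mul_pd_comm {g : Metric n M} {m : ℕ} {ψ lam : M → ℝ}
    (h : IsGeneralizedQuasiEinstein m g ψ lam) (he : e ∈ atlas (Euc n) M) {y : Euc n}
    (hy : y ∈ e.target) (i j : Fin n) :
    pd i (inChart e lam) y * pd j (inChart e ψ) y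
      = pd j (inChart e lam) y * pd i (inChart e ψ) y := by
  classical
  -- With at most one index the minors are trivial. The case is separate because 1 + (n-2)/m
  -- vanishes for n = m = 1.
  rcases lt_or_ge n 2 with hn | hn
  · have : i = j := Fin.ext (by omega)
    rw [this]
  set U : Opens (Euc n) := ⟨e.target, e.open_target⟩ with hU
  let D := pdDerivation U
  let f : smoothFun U :=
    ⟨fun y => inChart e ψ y, _, contDiffOn_inChart h.smooth_potential he, fun _ => rfl⟩
  let μ : smoothFun U :=
    ⟨fun y => inChart e lam y, _, contDiffOn_inChart h.smooth_lam he, fun _ => rfl⟩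
  let G : Matrix (Fin n) (Fin n) (smoothFun U) := Matrix.of fun i j =>
    ⟨fun y => metricMatrix g e y i j, _, contDiffOn_metricMatrix g he i j, fun _ => rfl⟩
  have hGval : ∀ z : U, (evalSmooth z).mapMatrix G = metricMatrix g e z := fun z => rfl
  have hdet : IsUnit G.det := isUnit_smoothFun fun z => by
    have : (G.det).1 z = (metricMatrix g e z).det := by
      rw [← hGval, ← RingHom.map_det]; rfl
    rw [this]
    exact det_metricMatrix_ne_zero g he z.2
  set H := G⁻¹ with hH
  have hHG : H * G = 1 := Matrix.nonsing_inv_mul _ hdet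
  -- Evaluation is a ring homomorphism, so it carries the inverse over the function ring to the
  -- pointwise inverse.
  have hHval : ∀ (z : U) a b, (metricMatrix g e z)⁻¹ a b = (H a b).1 z := fun z a b => by
    have : (metricMatrix g e z)⁻¹ = (evalSmooth z).mapMatrix H :=
      Matrix.inv_eq_left_inv (by rw [← hGval, ← map_mul, hHG, map_one])
    rw [this]; rfl
  have hGs : G.transpose = G := by
    ext a b z
    exact g.symm _ _ _
  have LC := isLeviCivita_christoffelMatrix (D := D) pdDerivation_comm hGs hHG
  set A := christoffelMatrix D H G with hA
  have hΓ : ∀ (z : U) k a b, christoffel g e k a b z = (A a k b).1 z := fun z k a b => by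
    have hp : ∀ c a b, pd c (fun z => metricMatrix g e z a b) z = (D c (G a b)).1 z :=
      fun c a b => pd_eq_pdDerivation (fun _ => rfl) c z
    rw [christoffel]
    simp only [hp, hHval]
    rw [← evalSmooth_apply, hA, christoffelMatrix, Matrix.of_apply]
    have hs : ∀ (r : ℝ) (x : smoothFun U), evalSmooth z (r • x) = r * evalSmooth z x :=
      fun _ _ => rfl
    rw [hs]
    simp only [map_sum, map_mul, map_sub, map_add, evalSmooth_apply]
  have hpf : ∀ (z : U) a, pd a (inChart e ψ) z = (D a f).1 z := fun z a =>
    pd_eq_pdDerivation (fun _ => rfl) a z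
  have hpμ : ∀ (z : U) a, pd a (inChart e lam) z = (D a μ).1 z := fun z a =>
    pd_eq_pdDerivation (fun _ => rfl) a z
  have hric : ∀ (z : U) a b, ricci g e a b z = (ric D A a b).1 z := fun z a b => by
    have hp : ∀ c k a b, pd c (christoffel g e k a b) z = (D c (A a k b)).1 z :=
      fun c k a b => pd_eq_pdDerivation (fun z => hΓ z k a b) c z
    rw [← evalSmooth_apply, ric, map_sum, ricci, ← Finset.sum_add_distrib]
    refine Finset.sum_congr rfl fun k _ => ?_
    simp only [curv, Matrix.add_apply, Matrix.sub_apply, Matrix.mul_apply, matDeriv_apply,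
      map_add, map_sub, map_sum, map_mul, evalSmooth_apply, hp, hΓ, Finset.sum_sub_distrib,
      LC.torsion a]
  have hhess : ∀ (z : U) a b, hessian g e ψ a b z = (hess D A f a b).1 z := fun z a b => by
    have hp : pd a (pd b (inChart e ψ)) z = (D a (D b f)).1 z :=
      pd_eq_pdDerivation (fun z => hpf z b) a z
    simp only [hessian, hp, hΓ, hpf, hess, ← evalSmooth_apply, map_sub, map_sum, map_mul]
  have key := LC.wedge_eq_zero hHG (f := f) (μ := μ)
    (c := algebraMap ℝ (smoothFun U) (1 / (m : ℝ))) (fun i => (D i).map_algebraMap _)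
    (fun a b => by
      ext z
      have := h.equation e he z z.2 a b
      rw [hric, hhess, hpf, hpf] at this
      exact this) i j
  have hm : (0 : ℝ) < m := by exact_mod_cast h.pos
  have key' := congrArg (evalSmooth (⟨y, hy⟩ : U)) key
  simp only [map_mul, map_sub, map_add, map_one, map_natCast, map_ofNat, map_zero,
    Fintype.card_fin] at key'
  simp only [evalSmooth_apply] at key'
  rw [← hpf, ← hpf, ← hpμ, ← hpμ] at key'
  have hn' : (2 : ℝ) ≤ n := by exact_mod_cast hn
  have hpos : 2 * (1 + (1 / (m : ℝ)) * ((n : ℝ) - 2)) ≠ 0 := by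
    have : 0 ≤ (1 / (m : ℝ)) * ((n : ℝ) - 2) := mul_nonneg (by positivity) (by linarith)
    positivity
  exact sub_eq_zero.1 ((mul_eq_zero.1 key').resolve_left hpos)

end Charts

end QuasiEinstein

end

noncomputable section

namespace QuasiEinstein

/-! ### Functions with parallel differentials -/

section ParallelDifferentials

open TopologicalSpace Filter Topology

theorem pd_mul {n : ℕ} {F G : Euc n → ℝ} {y : Euc n} (hF : DifferentiableAt ℝ F y)
    (hG : DifferentiableAt ℝ G y) (i : Fin n) :
    pd i (fun z => F z * G z) y = F y * pd i G y + G y * pd i F y := by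
  rw [pd, fderiv_fun_mul hF hG]; rfl

/-- If `df` is parallel to `dμ`, then the zeros of `df` are not isolated where `dμ ≠ 0`, because
`df / dμ` is constant on the level sets of `μ`. -/
theorem frequently_pd_eq_zero {n : ℕ} (hn : 2 ≤ n) {U : Opens (Euc n)} {f μ : Euc n → ℝ}
    (hf : ContDiffOn ℝ ∞ f U) (hμ : ContDiffOn ℝ ∞ μ U)
    (h : ∀ y ∈ U, ∀ i j, pd i μ y * pd j f y = pd j μ y * pd i f y) {y₀ : Euc n} (hy₀ : y₀ ∈ U)
    (hf₀ : ∀ k, pd k f y₀ = 0) {i : Fin n} (hi : pd i μ y₀ ≠ 0) :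
    ∃ᶠ y in 𝓝[≠] y₀, ∀ k, pd k f y = 0 := by
  have : Nontrivial (Fin n) := Fin.nontrivial_iff_two_le.2 hn
  obtain ⟨j, hj⟩ := exists_ne i
  have hpd : ∀ {F : Euc n → ℝ}, ContDiffOn ℝ ∞ F U → ∀ k, ∀ y ∈ U,
      DifferentiableAt ℝ (pd k F) y := fun hF k y hy =>
    ((contDiffOn_pd hF k).differentiableOn (by simp)).differentiableAt (U.isOpen.mem_nhds hy)
  -- A field tangent to the level sets of μ, nonzero wherever ∂ᵢμ ≠ 0; the second index `j` needs n
  -- ≥ 2.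
  set X : Euc n → Euc n := fun y => pd j μ y • stdVec i - pd i μ y • stdVec j with hX
  have hXs : ContDiffAt ℝ 1 X y₀ := by
    have hk : ∀ k, ContDiffAt ℝ 1 (pd k μ) y₀ := fun k =>
      ((contDiffOn_pd hμ k).contDiffAt (U.isOpen.mem_nhds hy₀)).of_le (by norm_cast)
    exact ((hk j).smul contDiffAt_const).sub ((hk i).smul contDiffAt_const)
  have hX₀ : X y₀ ≠ 0 := fun h0 => by
    have := congrArg (fun v : Euc n => v j) h0
    simp [hX, stdVec, hj, hi] at this
  set V : Set (Euc n) := {y | y ∈ U ∧ pd i μ y ≠ 0} with hV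
  have hVn : ∀ᶠ y in 𝓝 y₀, y ∈ V :=
    (U.isOpen.eventually_mem hy₀).and ((hpd hμ i y₀ hy₀).continuousAt.eventually_ne hi)
  set ρ : Euc n → ℝ := fun y => pd i f y / pd i μ y with hρ
  have hρd : ∀ y ∈ V, DifferentiableAt ℝ ρ y := fun y hy => by
    simp only [hρ, div_eq_mul_inv]
    exact (hpd hf i y hy.1).fun_mul ((hpd hμ i y hy.1).fun_inv hy.2)
  have hρX : ∀ y ∈ V, fderiv ℝ ρ y (X y) = 0 := fun y hy => by
    have hq : ∀ k, pd k ρ y * pd i μ y + ρ y * pd k (pd i μ) y = pd k (pd i f) y := fun k => by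
      have h1 := pd_mul (hρd y hy) (hpd hμ i y hy.1) k
      have h2 : (fun z => ρ z * pd i μ z) =ᶠ[𝓝 y] pd i f := by
        filter_upwards [(hpd hμ i y hy.1).continuousAt.eventually_ne hy.2] with z hz
        exact div_mul_cancel₀ _ hz
      rw [pd, h2.fderiv_eq, ← pd] at h1
      rw [h1]; ring
    -- The minor relation is differentiated along `i`. Substituting df = ρ dμ and commuting
    -- partials, the terms in second derivatives of μ cancel, leaving the (i, j) component of dρ ∧
    -- dμ = 0.
    have hd : pd i (fun z => pd i μ z * pd j f z) y = pd i (fun z => pd j μ z * pd i f z) y :=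
      pd_congr (fun z hz => h z hz i j) i hy.1
    rw [pd_mul (hpd hμ i y hy.1) (hpd hf j y hy.1), pd_mul (hpd hμ j y hy.1) (hpd hf i y hy.1),
      pd_comm (hf.contDiffAt (U.isOpen.mem_nhds hy.1)) i j,
      pd_comm (hμ.contDiffAt (U.isOpen.mem_nhds hy.1)) i j, ← hq i, ← hq j] at hd
    have hfi : pd i f y = ρ y * pd i μ y := (div_mul_cancel₀ _ hy.2).symm
    have hfj : pd j f y = ρ y * pd j μ y := by
      refine mul_left_cancel₀ hy.2 ?_
      rw [h y hy.1 i j, hfi]; ring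
    rw [hfi, hfj] at hd
    have e : fderiv ℝ ρ y (X y) = pd j μ y * pd i ρ y - pd i μ y * pd j ρ y := by
      simp only [hX, map_sub, map_smul, smul_eq_mul]; rfl
    rw [e]
    refine mul_left_cancel₀ hy.2 ?_
    linear_combination -hd
  -- Integral curve of `X` through `y₀`; along it ρ keeps its initial value 0, so df vanishes there.
  obtain ⟨γ, hγ₀, ε, hε, hγ⟩ :=
    hXs.exists_forall_mem_closedBall_exists_eq_forall_mem_Ioo_hasDerivAt₀ 0
  have hγ' : HasDerivAt γ (X y₀) 0 := by
    have := hγ 0 (by simp [hε])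
    rwa [hγ₀] at this
  have hγV : ∀ᶠ t in 𝓝 (0 : ℝ), γ t ∈ V := by
    have := hγ'.continuousAt.tendsto
    rw [hγ₀] at this
    exact this.eventually hVn
  have hIoo : ∀ᶠ t in 𝓝 (0 : ℝ), t ∈ Set.Ioo (0 - ε) (0 + ε) :=
    Ioo_mem_nhds (by linarith) (by linarith)
  obtain ⟨δ, hδ, hδV⟩ := Metric.eventually_nhds_iff_ball.1 (hγV.and hIoo)
  have hderiv : ∀ t ∈ Metric.ball (0 : ℝ) δ, HasDerivAt (fun t => ρ (γ t)) 0 t := fun t ht => by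
    have := (hρd _ (hδV t ht).1).hasFDerivAt.comp_hasDerivAt t (hγ t (hδV t ht).2)
    rwa [hρX _ (hδV t ht).1] at this
  have hconst : ∀ t ∈ Metric.ball (0 : ℝ) δ, ρ (γ t) = 0 := fun t ht => by
    have := Metric.isOpen_ball.is_const_of_deriv_eq_zero
      (convex_ball (0 : ℝ) δ).isPreconnected
      (fun t ht => (hderiv t ht).differentiableAt.differentiableWithinAt)
      (fun t ht => (hderiv t ht).deriv) ht (Metric.mem_ball_self hδ)
    rw [this, hγ₀, hρ]
    simp [hf₀]
  have hzero : ∀ᶠ t in 𝓝[≠] (0 : ℝ), ∀ k, pd k f (γ t) = 0 := by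
    filter_upwards [nhdsWithin_le_nhds (Metric.ball_mem_nhds 0 hδ)] with t ht k
    have hV := (hδV t ht).1
    have hi0 : pd i f (γ t) = 0 := (div_eq_zero_iff.1 (hconst t ht)).resolve_right hV.2
    have := h _ hV.1 i k
    rw [hi0, mul_zero] at this
    exact (mul_eq_zero.1 this).resolve_left hV.2
  -- The nonzero initial velocity forces γ off `y₀` at small nonzero times.
  have htend : Tendsto γ (𝓝[≠] 0) (𝓝[≠] y₀) :=
    tendsto_nhdsWithin_iff.2 ⟨by
      have := hγ'.continuousAt.tendsto
      rw [hγ₀] at this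
      exact this.mono_left nhdsWithin_le_nhds, hγ'.eventually_ne hX₀⟩
  exact htend.frequently hzero.frequently

end ParallelDifferentials

/-! ### Gradients -/

section Gradients

open TopologicalSpace Filter Topology

variable {n : ℕ} {M : Type*} [TopologicalSpace M] [ChartedSpace (Euc n) M]
  [IsManifold (𝓡 n) ∞ M]

theorem eq_of_inner_eq (g : Metric n M) {x : M} {a b : TangentSpace (𝓡 n) x}
    (h : ∀ v, g.inner x a v = g.inner x b v) : a = b := by
  by_contra hne
  refine (g.pos x (a - b) (sub_ne_zero.2 hne)).ne' ?_
  rw [map_sub, g.symm x _ a, g.symm x _ b, h, sub_self]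

theorem grad_eq_zero_iff (g : Metric n M) (f : M → ℝ) (x : M) :
    grad g f x = 0 ↔ differential n f x = 0 := by
  refine ⟨fun h => ?_, fun h => eq_of_inner_eq g fun v => ?_⟩
  · ext v
    rw [← inner_grad g, h, map_zero]
  · rw [inner_grad, h, map_zero]

theorem grad_eq_smul_grad (g : Metric n M) {f μ : M → ℝ} {x : M} {c : ℝ}
    (h : differential n μ x = c • differential n f x) : grad g μ x = c • grad g f x :=
  eq_of_inner_eq g fun v => by
    rw [inner_grad, h, map_smul, _root_.smul_apply, _root_.smul_apply,
      inner_grad]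

theorem differential_eq_zero_iff {f : M → ℝ} (hf : ContMDiff (𝓡 n) 𝓘(ℝ, ℝ) ∞ f)
    {e : OpenPartialHomeomorph M (Euc n)} (he : e ∈ atlas (Euc n) M) {y : Euc n}
    (hy : y ∈ e.target) : differential n f (e.symm y) = 0 ↔ ∀ i, pd i (inChart e f) y = 0 := by
  refine ⟨fun h i => by rw [pd_inChart hf he hy, h]; rfl, fun h => ?_⟩
  ext v
  obtain ⟨a, rfl⟩ := exists_eq_sum_coordVec he hy v
  simp only [map_sum, map_smul]
  exact Finset.sum_congr rfl fun i _ => by rw [← pd_inChart hf he hy, h]; rfl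

/-- The quotient `dμ / df` of parallel differentials, and zero where `df = 0`. -/
def differentialRatio (g : Metric n M) (f μ : M → ℝ) (x : M) : ℝ :=
  differential n μ x (grad g f x) / differential n f x (grad g f x)

/-- Evaluate the wedge on (v, ∇f) and divide by df(∇f) = |∇f|² > 0. -/
theorem differential_eq_ratio_smul (g : Metric n M) {f μ : M → ℝ} {x : M}
    (h : wedge (differential n μ x) (differential n f x) = 0) (hx : grad g f x ≠ 0) :
    differential n μ x = differentialRatio g f μ x • differential n f x := by
  ext v
  have h0 : differential n f x (grad g f x) ≠ 0 := by
    rw [← inner_grad g]; exact (g.pos x _ hx).ne'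
  have h1 : differential n μ x v * differential n f x (grad g f x)
      - differential n f x v * differential n μ x (grad g f x) = 0 := by
    have := congrFun (congrFun h v) (grad g f x)
    simpa only [wedge, Pi.zero_apply] using this
  rw [_root_.smul_apply, differentialRatio, smul_eq_mul]
  field_simp
  linear_combination h1

/-- Near a regular point some ∂ᵢf is nonzero, and the ratio equals ∂ᵢμ / ∂ᵢf in the chart. -/
theorem contMDiffOn_differentialRatio (g : Metric n M) {f μ : M → ℝ}
    (hf : ContMDiff (𝓡 n) 𝓘(ℝ, ℝ) ∞ f) (hμ : ContMDiff (𝓡 n) 𝓘(ℝ, ℝ) ∞ μ)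
    (h : ∀ x, wedge (differential n μ x) (differential n f x) = 0) :
    ContMDiffOn (𝓡 n) 𝓘(ℝ, ℝ) ∞ (differentialRatio g f μ) {x | grad g f x ≠ 0} := by
  intro x hx
  apply ContMDiffAt.contMDiffWithinAt
  set e := chartAt (Euc n) x with he_def
  have he : e ∈ atlas (Euc n) M := chart_mem_atlas _ _
  have hxs : x ∈ e.source := mem_chart_source _ x
  let U : Opens (Euc n) := ⟨e.target, e.open_target⟩
  have hxU : e x ∈ U := e.map_source hxs
  have hsx : e.symm (e x) = x := e.left_inv hxs
  have hne : ∃ i, pd i (inChart e f) (e x) ≠ 0 := by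
    by_contra! h0
    refine hx ((grad_eq_zero_iff g f x).2 ?_)
    have := (differential_eq_zero_iff hf he hxU).2 h0
    rwa [hsx] at this
  obtain ⟨i, hi⟩ := hne
  have hfs : ContDiffOn ℝ ∞ (pd i (inChart e f)) U :=
    contDiffOn_pd (U := U) (contDiffOn_inChart hf he) i
  have hμs : ContDiffOn ℝ ∞ (pd i (inChart e μ)) U :=
    contDiffOn_pd (U := U) (contDiffOn_inChart hμ he) i
  have hUn : (U : Set (Euc n)) ∈ 𝓝 (e x) := U.isOpen.mem_nhds hxU
  have hquot : ContDiffAt ℝ ∞ (fun y => pd i (inChart e μ) y / pd i (inChart e f) y) (e x) :=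
    (hμs.contDiffAt hUn).div (hfs.contDiffAt hUn) hi
  have hcomp := hquot.contMDiffAt.comp x
    (contMDiffAt_of_mem_maximalAtlas (IsManifold.subset_maximalAtlas he) hxs)
  refine hcomp.congr_of_eventuallyEq ?_
  have hev : ∀ᶠ z in 𝓝 x, pd i (inChart e f) (e z) ≠ 0 :=
    (e.continuousAt hxs).eventually ((hfs.contDiffAt hUn).continuousAt.eventually_ne hi)
  filter_upwards [e.open_source.mem_nhds hxs, hev] with z hz hzi
  have hzU := e.map_source hz
  have e1 := pd_inChart hf he hzU i
  have e2 := pd_inChart hμ he hzU i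
  have hgz : grad g f (e.symm (e z)) ≠ 0 := fun h0 =>
    hzi ((differential_eq_zero_iff hf he hzU).1 ((grad_eq_zero_iff g f _).1 h0) i)
  rw [differential_eq_ratio_smul g (h _) hgz, _root_.smul_apply, ← e1, smul_eq_mul,
    e.left_inv hz] at e2
  simp only [Function.comp]
  rw [e2, mul_div_cancel_right₀ _ hzi]

/-- Where `df` has an isolated zero, a differential that is parallel to `df` nearby vanishes. -/
theorem differential_eq_zero_of_discrete (hn : 2 ≤ n) (g : Metric n M) {f μ : M → ℝ}
    (hf : ContMDiff (𝓡 n) 𝓘(ℝ, ℝ) ∞ f) (hμ : ContMDiff (𝓡 n) 𝓘(ℝ, ℝ) ∞ μ)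
    (h : ∀ e ∈ atlas (Euc n) M, ∀ y ∈ e.target, ∀ i j,
      pd i (inChart e μ) y * pd j (inChart e f) y = pd j (inChart e μ) y * pd i (inChart e f) y)
    (hd : DiscreteTopology {x : M | grad g f x = 0}) {x : M} (hx : grad g f x = 0) :
    differential n μ x = 0 := by
  set e := chartAt (Euc n) x with he_def
  have he : e ∈ atlas (Euc n) M := chart_mem_atlas _ _
  have hxs : x ∈ e.source := mem_chart_source _ x
  let U : Opens (Euc n) := ⟨e.target, e.open_target⟩
  have hxU : e x ∈ U := e.map_source hxs
  have hsx : e.symm (e x) = x := e.left_inv hxs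
  suffices H : ∀ i, pd i (inChart e μ) (e x) = 0 by
    have := (differential_eq_zero_iff hμ he hxU).2 H
    rwa [hsx] at this
  intro i
  by_contra hi
  have hf₀ : ∀ k, pd k (inChart e f) (e x) = 0 := by
    rw [← differential_eq_zero_iff hf he hxU, hsx, ← grad_eq_zero_iff g]
    exact hx
  have hfreq := frequently_pd_eq_zero hn (U := U) (contDiffOn_inChart hf he)
    (contDiffOn_inChart hμ he) (h e he) hxU hf₀ hi
  have hiso : ∀ᶠ z in 𝓝[≠] x, grad g f z ≠ 0 := by
    have := disjoint_iff.2 (discreteTopology_subtype_iff.1 hd x hx)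
    exact disjoint_principal_right.1 this
  have htend : Tendsto e.symm (𝓝[≠] (e x)) (𝓝[≠] x) := by
    have h1 := (e.continuousAt_symm hxU).tendsto
    rw [hsx] at h1
    refine tendsto_nhdsWithin_iff.2 ⟨h1.mono_left nhdsWithin_le_nhds, ?_⟩
    filter_upwards [self_mem_nhdsWithin, nhdsWithin_le_nhds (U.isOpen.mem_nhds hxU)] with y hy hyU
    intro hyx
    exact hy (by rw [Set.mem_singleton_iff, ← e.right_inv hyU, hyx])
  refine hfreq ?_
  filter_upwards [htend.eventually hiso, nhdsWithin_le_nhds (U.isOpen.mem_nhds hxU)]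
    with y hy hyU h0
  exact hy ((grad_eq_zero_iff g f _).2 ((differential_eq_zero_iff hf he hyU).2 h0))

end Gradients

end QuasiEinstein

end

/-! ### The function u = exp(-ψ/m) and the final theorem -/

namespace QuasiEinstein

theorem wedge_smul_right {V : Type*} [AddCommGroup V] [Module ℝ V] [TopologicalSpace V]
    (α β : V →L[ℝ] ℝ) (c : ℝ) : wedge α (c • β) = c • wedge α β := by
  funext v w
  simp only [wedge, _root_.smul_apply, Pi.smul_apply, smul_eq_mul]
  ring

theorem differential_exp_neg_div {n : ℕ} {M : Type*} [TopologicalSpace M] [ChartedSpace (Euc n) M]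
    {ψ u : M → ℝ} (m : ℝ) (hψ : ContMDiff (𝓡 n) 𝓘(ℝ, ℝ) ∞ ψ)
    (hu : ∀ x, u x = Real.exp (-(ψ x) / m)) (x : M) :
    differential n u x = (-(u x / m)) • differential n ψ x := by
  have hu' : u = (fun t => Real.exp (-t / m)) ∘ ψ := funext hu
  have hd : HasDerivAt (fun t => Real.exp (-t / m)) (-(u x / m)) (ψ x) := by
    rw [hu]
    convert ((hasDerivAt_id' (ψ x)).fun_neg.div_const m).exp using 1
    ring
  have hc := (hd.hasFDerivAt.hasMFDerivAt.comp x
    (hψ.mdifferentiableAt (by simp)).hasMFDerivAt).mfderiv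
  rw [← hu'] at hc
  rw [differential, hc]
  ext v
  have hv : ∀ r : ℝ, ContinuousLinearMap.toSpanSingleton ℝ (-(u x / m)) r = -(u x / m) * r :=
    fun r => by rw [ContinuousLinearMap.toSpanSingleton_apply, smul_eq_mul, mul_comm]
  exact hv (differential n ψ x v)

end QuasiEinstein

theorem corollary3p1 {n : ℕ} {M : Type*} [TopologicalSpace M] [T2Space M]
    [SecondCountableTopology M] [ChartedSpace (QuasiEinstein.Euc n) M] [IsManifold (𝓡 n) ∞ M]
    (g : QuasiEinstein.Metric n M) (m : ℕ) (ψ lam u : M → ℝ)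
    (h : QuasiEinstein.IsGeneralizedQuasiEinstein m g ψ lam)
    (hu : ∀ x, u x = Real.exp (-(ψ x) / (m : ℝ))) :
    (∀ x : M,
      ((n : ℝ) + (m : ℝ) - 2) • QuasiEinstein.wedge
          (QuasiEinstein.differential n lam x) (QuasiEinstein.differential n u x)
        = (-(u x / (m : ℝ)) * ((n : ℝ) + (m : ℝ) - 2)) • QuasiEinstein.wedge
          (QuasiEinstein.differential n lam x) (QuasiEinstein.differential n ψ x) ∧
      ((n : ℝ) + (m : ℝ) - 2) • QuasiEinstein.wedge
          (QuasiEinstein.differential n lam x) (QuasiEinstein.differential n u x)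
        = 0 ∧
      QuasiEinstein.wedge
          (QuasiEinstein.differential n lam x) (QuasiEinstein.differential n ψ x)
        = 0) ∧
    (2 ≤ n →
      (∃ η : M → ℝ,
        ContMDiffOn (𝓡 n) 𝓘(ℝ, ℝ) ∞ η {x : M | QuasiEinstein.grad g ψ x ≠ 0} ∧
        ∀ x : M, QuasiEinstein.grad g ψ x ≠ 0 →
          QuasiEinstein.grad g lam x = η x • QuasiEinstein.grad g ψ x) ∧
      (DiscreteTopology {x : M | QuasiEinstein.grad g ψ x = 0} →
        ∃ η : M → ℝ, ∀ x : M,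
          QuasiEinstein.grad g lam x = η x • QuasiEinstein.grad g ψ x)) := by
  have hw : ∀ x : M, QuasiEinstein.wedge (QuasiEinstein.differential n lam x)
      (QuasiEinstein.differential n ψ x) = 0 := fun x => by
    have he := chart_mem_atlas (QuasiEinstein.Euc n) x
    have hy := (chartAt (QuasiEinstein.Euc n) x).map_source (mem_chart_source _ x)
    have := QuasiEinstein.wedge_differential_eq_zero h.smooth_potential h.smooth_lam he hy
      (QuasiEinstein.pd_mul_pd_comm h he hy)
    rwa [(chartAt (QuasiEinstein.Euc n) x).left_inv (mem_chart_source _ x)] at this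
  refine ⟨fun x => ⟨?_, ?_, hw x⟩, fun hn => ⟨⟨QuasiEinstein.differentialRatio g ψ lam,
    QuasiEinstein.contMDiffOn_differentialRatio g h.smooth_potential h.smooth_lam hw,
    fun x hx => QuasiEinstein.grad_eq_smul_grad g
      (QuasiEinstein.differential_eq_ratio_smul g (hw x) hx)⟩,
    fun hd => ⟨QuasiEinstein.differentialRatio g ψ lam, fun x => ?_⟩⟩⟩
  · rw [QuasiEinstein.differential_exp_neg_div m h.smooth_potential hu,
      QuasiEinstein.wedge_smul_right, smul_smul, mul_comm]
  · rw [QuasiEinstein.differential_exp_neg_div m h.smooth_potential hu,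
      QuasiEinstein.wedge_smul_right, hw, smul_zero, smul_zero]
  -- At a critical point both gradients vanish, so the default value of the ratio there is
  -- immaterial.
  · by_cases hx : QuasiEinstein.grad g ψ x = 0
    · rw [hx, smul_zero, QuasiEinstein.grad_eq_zero_iff]
      exact QuasiEinstein.differential_eq_zero_of_discrete hn g h.smooth_potential h.smooth_lam
        (fun e he y hy => QuasiEinstein.pd_mul_pd_comm h he hy) hd hx
    · exact QuasiEinstein.grad_eq_smul_grad g
        (QuasiEinstein.differential_eq_ratio_smul g (hw x) hx)
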